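/- Let $G$ be a countable group acting by isometries on a nonempty geodesic $\delta$-hyperbolic metric space $X$ (geodesic triangles are $\delta$-slim), with Gromov boundary $\partial X$. An element $g \in G$ is loxodromic if its translation length $\lim_{n\to\infty} d(g^n x, x)/n$ is positive; two loxodromic elements are independent if their fixed point sets in $\partial X$ are disjoint; a subsemigroup (or subgroup) of $G$ is nonelementary if it contains two independent loxodromic elements. A graph structure $(G,\Gamma)$ is a finite directed graph $\Gamma$ with an initial vertex $v_0$ from which every vertex can be reached by a directed path, whose edges are labelled by elements of $G$ so that distinct edges out of the same vertex have distinct labels; a finite path evaluates to the product of its labels. Let $S_n$ be the set of paths of length $n$ starting at $v_0$. Assume that $(G,\Gamma)$ is almost semisimple of growth $\lambda > 1$, i.e. there is $c>0$ with $c^{-1}\lambda^n \le \# S_n \le c\lambda^n$ for all $n \geq 0$. An irreducible component $C$ of $\Gamma$ (a class of mutually accessible vertices) is maximal if for some path $g$ from $v_0$ to a vertex of $C$, the set $P_g(C)$ of all concatenations of $g$ with a finite path lying entirely in $C$ satisfies $\limsup_n \sqrt[n]{\#(P_g(C)\cap S_n)} = \lambda$; a vertex is maximal if its component is. For a vertex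 $v$, the loop semigroup $\Gamma_v \subseteq G$ is the set of evaluations of the directed loops based at $v$. Let $H < G$ be a nonelementary subgroup, and suppose that $(G,\Gamma)$ is thick relatively to $H$: for every maximal vertex $v$ there is a finite set $B \subseteq G$ such that $H \subseteq B\,\Gamma_v B$. Then $(G,\Gamma)$ is nonelementary, i.e. for every maximal vertex $v$ the loop semigroup $\Gamma_v$ is nonelementary: it contains two independent loxodromic elements. -/

import Mathlib

open Filter Topology
open scoped Pointwise

noncomputable section

/-! ### Geodesic hyperbolic metric spaces and the Gromov boundary -/

section Hyperbolic

variable {X : Type*} [MetricSpace X]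

/-- `γ` restricted to `[0, dist x y]` is a geodesic segment from `x` to `y`. -/
structure IsGeodesicSegment (γ : ℝ → X) (x y : X) : Prop where
  source : γ 0 = x
  target : γ (dist x y) = y
  isometry : ∀ s ∈ Set.Icc 0 (dist x y), ∀ t ∈ Set.Icc 0 (dist x y), dist (γ s) (γ t) = |s - t|

variable (X) in
/-- Any two points are joined by a geodesic segment. -/
def IsGeodesicSpace : Prop :=
  ∀ x y : X, ∃ γ : ℝ → X, IsGeodesicSegment γ x y

variable (X) in
/-- Every side of every geodesic triangle lies in the `δ`-neighbourhood of the other two sides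
(one side suffices, since the vertices can be permuted). -/
def IsSlimHyperbolic (δ : ℝ) : Prop :=
  ∀ (x y z : X) (α β γ : ℝ → X),
    IsGeodesicSegment α x y → IsGeodesicSegment β y z → IsGeodesicSegment γ z x →
      ∀ s ∈ Set.Icc 0 (dist x y),
        (∃ t ∈ Set.Icc 0 (dist y z), dist (α s) (β t) ≤ δ) ∨
          ∃ t ∈ Set.Icc 0 (dist z x), dist (α s) (γ t) ≤ δ

/-- The Gromov product `(y, z)_x`. -/
def gromovProduct (x y z : X) : ℝ :=
  (dist x y + dist x z - dist y z) / 2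

/-- `(x_i, y_j)_o → ∞` as `i, j → ∞`, for one (equivalently, every) base point `o`. -/
def GromovAsymptotic (x y : ℕ → X) : Prop :=
  ∀ o : X, Tendsto (fun p : ℕ × ℕ => gromovProduct o (x p.1) (y p.2)) atTop atTop

variable (X) in
/-- Sequences converging to infinity: `(x_i, x_j)_o → ∞` as `i, j → ∞`. -/
def GromovSequence : Type _ :=
  {x : ℕ → X // GromovAsymptotic x x}

variable (X) in
/-- The (sequential) Gromov boundary: sequences converging to infinity, modulo
`x ∼ y` iff `(x_i, y_j)_o → ∞`. In a hyperbolic space `∼` is already an equivalence relation, so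
that passing to the equivalence relation it generates, as `Quot` does, changes nothing. -/
def GromovBoundary : Type _ :=
  Quot fun x y : GromovSequence X => GromovAsymptotic x.1 y.1

end Hyperbolic

/-! ### Isometric actions, loxodromic elements, nonelementary semigroups -/

section Action

variable {G : Type*} [Group G] (X : Type*) [MetricSpace X] [MulAction G X] [IsIsometricSMul G X]

variable {X} in
theorem GromovAsymptotic.smul {x y : ℕ → X} (h : GromovAsymptotic x y) (g : G) :
    GromovAsymptotic (fun n => g • x n) (fun n => g • y n) := by
  intro o
  have key : ∀ a : X, dist o (g • a) = dist (g⁻¹ • o) a := fun a => by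
    rw [← dist_smul g (g⁻¹ • o) a, smul_inv_smul]
  simpa only [gromovProduct, key, dist_smul] using h (g⁻¹ • o)

/-- The action of `G` on the Gromov boundary, `g • [x_n] = [g • x_n]`. -/
instance GromovBoundary.instSMul : SMul G (GromovBoundary X) where
  smul g := Quot.map (fun x => ⟨fun n => g • x.1 n, x.2.smul g⟩) fun _ _ h => h.smul g

/-- The translation length `lim d(gⁿ x, x) / n`, which exists and does not depend on `x`, is `τ`. -/
def HasTranslationLength (g : G) (τ : ℝ) : Prop :=
  ∀ x : X, Tendsto (fun n : ℕ => dist (g ^ n • x) x / n) atTop (𝓝 τ)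

/-- `g` acts on `X` with positive translation length. -/
def IsLoxodromic (g : G) : Prop :=
  ∃ τ : ℝ, 0 < τ ∧ HasTranslationLength X g τ

/-- The points of the Gromov boundary that are fixed by `g`. -/
def boundaryFixedPoints (g : G) : Set (GromovBoundary X) :=
  {ξ | g • ξ = ξ}

/-- Two loxodromic elements whose fixed point sets on the boundary are disjoint. -/
def AreIndependentLoxodromics (g h : G) : Prop :=
  IsLoxodromic X g ∧ IsLoxodromic X h ∧
    Disjoint (boundaryFixedPoints X g) (boundaryFixedPoints X h)

/-- The action on `X` of the semigroup (or group) with underlying set `L` is nonelementary: `L`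
contains two independent loxodromics. -/
def IsNonelementary (L : Set G) : Prop :=
  ∃ g ∈ L, ∃ h ∈ L, AreIndependentLoxodromics X g h

end Action

/-! ### Graph structures -/

/-- A graph structure on the countable group `G`: a finite directed graph (a quiver, so that
multiple edges and loops are allowed) with an initial vertex from which every vertex can be reached,
and with edges labelled by elements of `G`, such that distinct edges out of the same vertex have
distinct labels. -/
structure GraphStructure (G : Type*) [Group G] (V : Type*) [Quiver V] where
  countable_group : Countable G
  finite_vertices : Finite V
  finite_edges : ∀ u w : V, Finite (u ⟶ w)
  /-- The initial vertex. -/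
  init : V
  reachable : ∀ v : V, Nonempty (Quiver.Path init v)
  /-- The evaluation map on edges. -/
  label : ∀ {u w : V}, (u ⟶ w) → G
  label_injective : ∀ u : V, Function.Injective fun e : Σ w : V, (u ⟶ w) => label e.2

namespace GraphStructure

variable {G : Type*} [Group G] {V : Type*} [Quiver V] (Γ : GraphStructure G V)

/-- The evaluation of a finite path: `e₁ ⋯ eₙ` is sent to the product of the labels. -/
def ev {u w : V} (p : Quiver.Path u w) : G :=
  p.weight Γ.label

/-- The loop semigroup `Γ_v` of `v`: the image in `G` of the loops based at `v`. -/
def loopSemigroup (v : V) : Subsemigroup G where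
  carrier := Set.range fun p : Quiver.Path v v => Γ.ev p
  mul_mem' := by
    rintro _ _ ⟨p, rfl⟩ ⟨q, rfl⟩
    exact ⟨p.comp q, Quiver.Path.weight_comp _ p q⟩

/-- `Ω₀`: the finite paths that start at the initial vertex. -/
abbrev InitialPath : Type _ :=
  Σ w : V, Quiver.Path Γ.init w

/-- `S_n`: the paths of length `n` that start at the initial vertex. -/
def sphere (n : ℕ) : Set Γ.InitialPath :=
  {p | p.2.length = n}

/-- Almost semisimple of growth `lam > 1`: `# S_n` has pure exponential growth `lam ^ n`. -/
def IsAlmostSemisimple (lam : ℝ) : Prop :=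
  1 < lam ∧ ∃ c : ℝ, 0 < c ∧
    ∀ n : ℕ, c⁻¹ * lam ^ n ≤ (Γ.sphere n).ncard ∧ ((Γ.sphere n).ncard : ℝ) ≤ c * lam ^ n

/-- The growth `limsup (# (A ∩ S_n)) ^ (1 / n)` of a set `A` of paths in `Ω₀`. -/
def growth (A : Set Γ.InitialPath) : ℝ :=
  limsup (fun n : ℕ => ((A ∩ Γ.sphere n).ncard : ℝ) ^ (1 / (n : ℝ))) atTop

/-- `P_g(C)`: the concatenations of `g` with a path that lies entirely in the component `C`. -/
def pathsInto (C : Quiver.StronglyConnectedComponent V) (g : Γ.InitialPath) :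
    Set Γ.InitialPath :=
  {q | ∃ p : Quiver.Path g.1 q.1, q.2 = g.2.comp p ∧
    ∀ x ∈ p.vertices, Quiver.StronglyConnectedComponent.mk x = C}

/-- The irreducible component `C` is maximal: for some path `g` from the initial vertex to a vertex
of `C`, the set `P_g(C)` has growth `lam`. -/
def IsMaximalComponent (lam : ℝ) (C : Quiver.StronglyConnectedComponent V) : Prop :=
  ∃ g : Γ.InitialPath, Quiver.StronglyConnectedComponent.mk g.1 = C ∧
    Γ.growth (Γ.pathsInto C g) = lam

/-- A vertex is maximal (of maximal growth) if its irreducible component is. -/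
def IsMaximalVertex (lam : ℝ) (v : V) : Prop :=
  Γ.IsMaximalComponent lam (Quiver.StronglyConnectedComponent.mk v)

/-- Thick relatively to the subgroup `H`: for every maximal vertex `v`, there is a finite `B ⊆ G`
such that `H ⊆ B Γ_v B`. -/
def IsThickRelativeTo (lam : ℝ) (H : Subgroup G) : Prop :=
  ∀ v : V, Γ.IsMaximalVertex lam v →
    ∃ B : Set G, B.Finite ∧ (H : Set G) ⊆ B * (Γ.loopSemigroup v : Set G) * B

end GraphStructure

end

/-! Thickness reduces the theorem to a statement about sets: if `H ⊆ B * L * B` with `B` finite and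
`H` nonelementary, then `L` is nonelementary (`IsNonelementary.of_subset_mul_mul`). Let `f, g ∈ H`
be independent loxodromics, `t` a large power of `f`, and `ξ` the attracting point of `t`. The
conjugates `k n = t ^ n * g * (t ^ n)⁻¹` lie in `H`, and both `k n` and `(k n)⁻¹` push a base point
to `ξ`, because `g` and `g⁻¹` move the repelling point of `t`
(`exists_gromovSequence_of_independent`). So `a * k n * b⁻¹` has forward orbit points tending to `a
• ξ` and backward ones to `b • ξ`. When these differ it is eventually loxodromic, and pairwise
distinct limits make two such elements independent (`eventually_areIndependentLoxodromics`).
Elements of `H` enter `L` only after correction on both sides by unknown elements of `B`. Since `ξ`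
has an infinite `g`-orbit, four of its points can be chosen so far apart that no correction makes
their translates coincide; one `n` then serves all corrections. -/

/-! ### Gromov products and the four-point inequality. -/

section GromovProduct

variable {X : Type*} [MetricSpace X]

variable (X) in
/-- The four-point inequality for Gromov products. -/
def FourPointHyperbolic (D : ℝ) : Prop :=
  ∀ o x y z : X, min (gromovProduct o x y) (gromovProduct o y z) - D ≤ gromovProduct o x z

theorem gromovProduct_comm (o x y : X) : gromovProduct o x y = gromovProduct o y x := by
  simp only [gromovProduct, dist_comm x y]
  ring

theorem gromovProduct_nonneg (o x y : X) : 0 ≤ gromovProduct o x y := by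
  have := dist_triangle_left x y o
  simp only [gromovProduct]
  linarith

theorem gromovProduct_add_gromovProduct (o x y : X) :
    gromovProduct o x y + gromovProduct x o y = dist o x := by
  simp only [gromovProduct, dist_comm x o]
  ring

theorem gromovProduct_sub_dist_le_right (o x y z : X) :
    gromovProduct o x y - dist z y ≤ gromovProduct o x z := by
  have h1 := dist_triangle o z y
  have h2 := dist_triangle x y z
  simp only [gromovProduct, dist_comm y z] at *
  linarith

theorem gromovProduct_sub_dist_le_base (o o' x y : X) :
    gromovProduct o x y - dist o o' ≤ gromovProduct o' x y := by
  have h1 := dist_triangle o o' x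
  have h2 := dist_triangle o o' y
  simp only [gromovProduct]
  linarith

theorem gromovProduct_le_dist_of_dist_add_dist_le {o x y p : X}
    (h : dist x p + dist p y ≤ dist x y) : gromovProduct o x y ≤ dist o p := by
  have h1 := dist_triangle o p x
  have h2 := dist_triangle o p y
  simp only [gromovProduct, dist_comm p x] at *
  linarith

namespace IsGeodesicSegment

variable {γ : ℝ → X} {x y : X}

theorem dist_source (h : IsGeodesicSegment γ x y) {t : ℝ} (ht : t ∈ Set.Icc 0 (dist x y)) :
    dist x (γ t) = t := by
  have := h.isometry 0 ⟨le_rfl, dist_nonneg⟩ t ht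
  rwa [h.source, zero_sub, abs_neg, abs_of_nonneg ht.1] at this

theorem dist_target (h : IsGeodesicSegment γ x y) {t : ℝ} (ht : t ∈ Set.Icc 0 (dist x y)) :
    dist (γ t) y = dist x y - t := by
  have := h.isometry t ht (dist x y) ⟨dist_nonneg, le_rfl⟩
  rwa [h.target, abs_sub_comm, abs_of_nonneg (sub_nonneg.2 ht.2)] at this

end IsGeodesicSegment

/-- The point of `[x, z]` at distance `(o, z)_x` from `x` lies within `(x, z)_o + 2δ` of `o`. It is
also `δ`-close to `[z, y]` or `[y, x]`, whose distance from `o` is at least the corresponding Gromov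
product. -/
theorem IsSlimHyperbolic.fourPoint {δ : ℝ} (hgeo : IsGeodesicSpace X)
    (hhyp : IsSlimHyperbolic X δ) : FourPointHyperbolic X (3 * δ) := by
  intro o x y z
  obtain ⟨α, hα⟩ := hgeo x z
  obtain ⟨β, hβ⟩ := hgeo z o
  obtain ⟨γ, hγ⟩ := hgeo o x
  obtain ⟨β', hβ'⟩ := hgeo z y
  obtain ⟨γ', hγ'⟩ := hgeo y x
  have hs : gromovProduct x o z ∈ Set.Icc 0 (dist x z) := by
    refine ⟨gromovProduct_nonneg _ _ _, ?_⟩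
    have := gromovProduct_add_gromovProduct x z o
    have := gromovProduct_nonneg z x o
    rw [gromovProduct_comm]
    linarith
  set s := gromovProduct x o z with hsdef
  have hxp := hα.dist_source hs
  have hpz := hα.dist_target hs
  have key : dist o (α s) ≤ gromovProduct o x z + 2 * δ := by
    rcases hhyp x z o α β γ hα hβ hγ s hs with ⟨t, ht, hd⟩ | ⟨t, ht, hd⟩
    · have h1 := hβ.dist_source ht
      have h2 := hβ.dist_target ht
      have h3 := dist_triangle z (β t) (α s)
      have h4 := dist_triangle o (β t) (α s)
      rw [dist_comm o (β t), dist_comm (β t) (α s)] at h4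
      rw [dist_comm z (α s), dist_comm (β t) (α s)] at h3
      simp only [gromovProduct, dist_comm x o, dist_comm z o] at *
      linarith
    · have h1 := hγ.dist_source ht
      have h2 := hγ.dist_target ht
      have h3 := dist_triangle (α s) (γ t) x
      have h4 := dist_triangle o (γ t) (α s)
      rw [dist_comm (γ t) (α s)] at h4
      rw [dist_comm (α s) x] at h3
      simp only [gromovProduct, dist_comm x o] at *
      linarith
  rcases hhyp x z y α β' γ' hα hβ' hγ' s hs with ⟨t, ht, hd⟩ | ⟨t, ht, hd⟩
  · have h1 : gromovProduct o z y ≤ dist o (β' t) :=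
      gromovProduct_le_dist_of_dist_add_dist_le
        (by rw [hβ'.dist_source ht, hβ'.dist_target ht]; linarith)
    have h2 := dist_triangle o (α s) (β' t)
    have h3 := min_le_right (gromovProduct o x y) (gromovProduct o y z)
    rw [gromovProduct_comm] at h1
    linarith
  · have h1 : gromovProduct o y x ≤ dist o (γ' t) :=
      gromovProduct_le_dist_of_dist_add_dist_le
        (by rw [hγ'.dist_source ht, hγ'.dist_target ht]; linarith)
    have h2 := dist_triangle o (α s) (γ' t)
    have h3 := min_le_left (gromovProduct o x y) (gromovProduct o y z)
    rw [gromovProduct_comm] at h1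
    linarith

theorem FourPointHyperbolic.nonneg [Nonempty X] {D : ℝ} (h : FourPointHyperbolic X D) :
    0 ≤ D := by
  obtain ⟨o⟩ := ‹Nonempty X›
  have := h o o o o
  simp [gromovProduct] at this
  exact this

/-! ### Asymptotic sequences -/

namespace GromovAsymptotic

variable {x y z : ℕ → X} {D : ℝ}

theorem of_base (o : X)
    (h : Tendsto (fun p : ℕ × ℕ => gromovProduct o (x p.1) (y p.2)) atTop atTop) :
    GromovAsymptotic x y := fun o' =>
  tendsto_atTop_mono (fun p => gromovProduct_sub_dist_le_base o o' (x p.1) (y p.2))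
    (tendsto_atTop_add_const_right _ (-dist o o') h)

theorem eventually_le (h : GromovAsymptotic x y) (o : X) (R : ℝ) :
    ∃ N, ∀ i ≥ N, ∀ j ≥ N, R ≤ gromovProduct o (x i) (y j) := by
  obtain ⟨⟨a, b⟩, hab⟩ := eventually_atTop.1 ((h o).eventually_ge_atTop R)
  exact ⟨max a b, fun i hi j hj =>
    hab (i, j) ⟨(le_max_left _ _).trans hi, (le_max_right _ _).trans hj⟩⟩

theorem of_eventually_le (o : X)
    (h : ∀ R : ℝ, ∃ N, ∀ i ≥ N, ∀ j ≥ N, R ≤ gromovProduct o (x i) (y j)) :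
    GromovAsymptotic x y :=
  of_base o <| tendsto_atTop.2 fun R =>
    let ⟨N, hN⟩ := h R
    eventually_atTop.2 ⟨(N, N), fun p hp => hN p.1 hp.1 p.2 hp.2⟩

theorem tendsto_diag (h : GromovAsymptotic x y) (o : X) :
    Tendsto (fun n => gromovProduct o (x n) (y n)) atTop atTop :=
  (h o).comp tendsto_atTop_diagonal

theorem symm (h : GromovAsymptotic x y) : GromovAsymptotic y x := fun o =>
  of_eventually_le o (fun R =>
    let ⟨N, hN⟩ := h.eventually_le o R
    ⟨N, fun i hi j hj => by rw [gromovProduct_comm]; exact hN j hj i hi⟩) o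

theorem trans [Nonempty X] (hD : FourPointHyperbolic X D) (h : GromovAsymptotic x y)
    (h' : GromovAsymptotic y z) : GromovAsymptotic x z := by
  obtain ⟨o⟩ := ‹Nonempty X›
  refine of_eventually_le o fun R => ?_
  obtain ⟨N, hN⟩ := h.eventually_le o (R + D)
  obtain ⟨M, hM⟩ := h'.eventually_le o (R + D)
  refine ⟨max N M, fun i hi j hj => ?_⟩
  have h1 := hN i ((le_max_left _ _).trans hi) (max N M) (le_max_left _ _)
  have h2 := hM (max N M) (le_max_right _ _) j ((le_max_right _ _).trans hj)
  have h3 := hD o (x i) (y (max N M)) (z j)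
  have h4 := le_min h1 h2
  linarith

theorem right_of_dist_le (h : GromovAsymptotic x y) {K : ℝ} (hK : ∀ n, dist (z n) (y n) ≤ K) :
    GromovAsymptotic x z := fun o =>
  tendsto_atTop_mono (fun p => (by
      have := gromovProduct_sub_dist_le_right o (x p.1) (y p.2) (z p.2)
      linarith [hK p.2] : gromovProduct o (x p.1) (y p.2) + -K ≤ _))
    (tendsto_atTop_add_const_right _ (-K) (h o))

theorem of_tendsto_diag (hD : FourPointHyperbolic X D) (hx : GromovAsymptotic x x) (o : X)
    (h : Tendsto (fun n => gromovProduct o (x n) (y n)) atTop atTop) :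
    GromovAsymptotic x y := by
  refine of_eventually_le o fun R => ?_
  obtain ⟨N, hN⟩ := hx.eventually_le o (R + D)
  obtain ⟨M, hM⟩ := eventually_atTop.1 (h.eventually_ge_atTop (R + D))
  refine ⟨max N M, fun i hi j hj => ?_⟩
  have h1 := hN i ((le_max_left _ _).trans hi) j ((le_max_left _ _).trans hj)
  have h2 := hM j ((le_max_right _ _).trans hj)
  have h3 := hD o (x i) (x j) (y j)
  have h4 := le_min h1 h2
  linarith

/-- Upgrades mere failure of divergence to a uniform bound: one large late product `(x i, y j)`
would, through two four-point inequalities along `x i', x i, y j, y j'`, make all late products at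
least `R`. -/
theorem exists_le_of_not (hD : FourPointHyperbolic X D) (hx : GromovAsymptotic x x)
    (hy : GromovAsymptotic y y) (h : ¬ GromovAsymptotic x y) (o : X) :
    ∃ K : ℝ, ∃ N, ∀ i ≥ N, ∀ j ≥ N, gromovProduct o (x i) (y j) ≤ K := by
  have : ∃ R : ℝ, ∀ N, ∃ i ≥ N, ∃ j ≥ N, gromovProduct o (x i) (y j) < R := by
    by_contra! hcon
    exact h (of_eventually_le o hcon)
  obtain ⟨R, hR⟩ := this
  obtain ⟨N, hN⟩ := hx.eventually_le o (R + 2 * D)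
  obtain ⟨M, hM⟩ := hy.eventually_le o (R + D)
  refine ⟨R + 2 * D, max N M, fun i hi j hj => ?_⟩
  by_contra! hlt
  obtain ⟨i', hi', j', hj', hlt'⟩ := hR (max N M)
  have h1 := hN i' ((le_max_left _ _).trans hi') i ((le_max_left _ _).trans hi)
  have h2 := hM j ((le_max_right _ _).trans hj) j' ((le_max_right _ _).trans hj')
  have h3 := hD o (x i') (x i) (y j)
  have h4 := hD o (x i') (y j) (y j')
  have h5 := le_min h1 hlt.le
  have h6 : R + D ≤ gromovProduct o (x i') (y j) := by linarith
  have h7 := le_min h6 h2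
  linarith

end GromovAsymptotic

/-- The boundary point represented by a sequence converging to infinity. -/
def GromovSequence.toBoundary (x : GromovSequence X) : GromovBoundary X :=
  Quot.mk _ x

theorem GromovSequence.toBoundary_eq_iff [Nonempty X] {D : ℝ} (hD : FourPointHyperbolic X D)
    {x y : GromovSequence X} :
    x.toBoundary = y.toBoundary ↔ GromovAsymptotic x.1 y.1 := by
  refine ⟨fun h => ?_, fun h => Quot.sound h⟩
  have e : Equivalence fun x y : GromovSequence X => GromovAsymptotic x.1 y.1 :=
    ⟨fun x => x.2, fun h => h.symm, fun h h' => h.trans hD h'⟩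
  exact (Equivalence.eqvGen_iff e).1 (Quot.eqvGen_exact h)

end GromovProduct

/-- Otherwise each doubling of the exponent adds less than `C`, so `f ^ 2 ^ k` has displacement
linear in `k`, against linear growth in `2 ^ k`. -/
theorem IsLoxodromic.exists_pow {G : Type*} [Group G] {X : Type*} [MetricSpace X]
    [MulAction G X] {f : G} (hf : IsLoxodromic X f) (o : X) (C : ℝ) :
    ∃ N : ℕ, 0 < N ∧ dist o (f ^ N • o) + C ≤ dist o ((f ^ N) ^ 2 • o) := by
  obtain ⟨τ, hτ, h⟩ := hf
  by_contra! hcon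
  have hbound : ∀ k : ℕ, dist (f ^ 2 ^ k • o) o ≤ dist (f • o) o + k * C := by
    intro k
    induction k with
    | zero => simp
    | succ k ih =>
      have := hcon (2 ^ k) (by positivity)
      rw [← pow_mul, ← pow_succ, dist_comm o, dist_comm o] at this
      push_cast
      linarith
  have h1 : Tendsto (fun k : ℕ => dist (f ^ 2 ^ k • o) o / ((2 ^ k : ℕ) : ℝ)) atTop (𝓝 τ) :=
    (h o).comp (tendsto_pow_atTop_atTop_of_one_lt one_lt_two)
  have h2 : Tendsto (fun k : ℕ => (dist (f • o) o + k * C) / ((2 ^ k : ℕ) : ℝ)) atTop (𝓝 0) := by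
    have ha : Tendsto (fun k : ℕ => dist (f • o) o * (1 / 2 : ℝ) ^ k) atTop
        (𝓝 (dist (f • o) o * 0)) :=
      (tendsto_pow_atTop_nhds_zero_of_lt_one (by norm_num) (by norm_num)).const_mul _
    have hb : Tendsto (fun k : ℕ => (k : ℝ) * (1 / 2 : ℝ) ^ k * C) atTop (𝓝 (0 * C)) :=
      (tendsto_self_mul_const_pow_of_lt_one (by norm_num) (by norm_num)).mul_const _
    have hc := ha.add hb
    simp only [mul_zero, zero_mul, add_zero] at hc
    refine hc.congr fun k => ?_
    push_cast
    rw [one_div, inv_pow]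
    field_simp
  have h3 : τ ≤ 0 := le_of_tendsto_of_tendsto' h1 h2 fun k => by
    gcongr
    exact hbound k
  linarith

/-! ### Isometries -/

section Isometries

variable {G : Type*} [Group G] {X : Type*} [MetricSpace X] [MulAction G X] [IsIsometricSMul G X]

theorem gromovProduct_smul (g : G) (o x y : X) :
    gromovProduct (g • o) (g • x) (g • y) = gromovProduct o x y := by
  simp only [gromovProduct, dist_smul]

theorem dist_inv_smul_self (g : G) (o : X) : dist o (g⁻¹ • o) = dist o (g • o) := by
  rw [← dist_smul g o (g⁻¹ • o), smul_inv_smul, dist_comm]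

theorem gromovProduct_smul_base (g : G) (o x y : X) :
    gromovProduct (g • o) x y = gromovProduct o (g⁻¹ • x) (g⁻¹ • y) := by
  rw [← gromovProduct_smul g o (g⁻¹ • x), smul_inv_smul, smul_inv_smul]

instance GromovBoundary.instMulAction : MulAction G (GromovBoundary X) where
  one_smul := by
    rintro ⟨x⟩
    exact congrArg (Quot.mk _) (Subtype.ext (funext fun n => one_smul G (x.1 n)))
  mul_smul := by
    rintro g h ⟨x⟩
    exact congrArg (Quot.mk _) (Subtype.ext (funext fun n => mul_smul g h (x.1 n)))

theorem GromovSequence.smul_toBoundary_eq_smul_iff [Nonempty X] {D : ℝ}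
    (hD : FourPointHyperbolic X D) {a b : G} {x y : GromovSequence X} :
    a • x.toBoundary = b • y.toBoundary ↔
      GromovAsymptotic (fun n => a • x.1 n) (fun n => b • y.1 n) :=
  toBoundary_eq_iff hD (x := ⟨_, x.2.smul a⟩) (y := ⟨_, y.2.smul b⟩)

theorem GromovSequence.smul_toBoundary_eq_iff [Nonempty X] {D : ℝ}
    (hD : FourPointHyperbolic X D) {a : G} {x y : GromovSequence X} :
    a • x.toBoundary = y.toBoundary ↔ GromovAsymptotic (fun n => a • x.1 n) y.1 :=
  toBoundary_eq_iff hD (x := ⟨_, x.2.smul a⟩)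

/-! ### From one displacement estimate to growth along all powers. -/

section Displacement

variable {D : ℝ} {s : G} {o : X}

theorem dist_sq_smul (s : G) (o : X) :
    dist o (s ^ 2 • o) = 2 * dist o (s • o) - 2 * gromovProduct o (s • o) (s⁻¹ • o) := by
  have : dist (s • o) (s⁻¹ • o) = dist o (s ^ 2 • o) := by
    rw [← dist_smul s (s • o), smul_inv_smul, dist_comm, pow_two, mul_smul]
  simp only [gromovProduct, this, dist_inv_smul_self]
  ring

/-- Local-to-global step. With `A = (s o, s⁻¹ o)_o`, the hypothesis says `2A + 2D + 1 ≤ d(o, s o)`.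
The induction hypothesis translated by `s` makes the product of `s² o` and `s ^ (n + 2) o` at `s o`
exceed `A + D`; were that of `o` and `s ^ (n + 2) o` also larger, the four-point inequality would
give `A < A`. -/
theorem gromovProduct_smul_pow_le (hD : FourPointHyperbolic X D) (hD0 : 0 ≤ D)
    (hs : dist o (s • o) + 2 * D + 1 ≤ dist o (s ^ 2 • o)) (n : ℕ) :
    gromovProduct (s • o) o (s ^ (n + 1) • o) ≤ gromovProduct o (s • o) (s⁻¹ • o) + D := by
  have hsq := dist_sq_smul s o
  have ha := gromovProduct_nonneg o (s • o) (s⁻¹ • o)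
  induction n with
  | zero =>
    have : gromovProduct (s • o) o (s ^ (0 + 1) • o) = 0 := by
      simp [gromovProduct, dist_comm (s • o) o]
    linarith
  | succ n ih =>
    have h1 : gromovProduct (s • s • o) (s • o) (s ^ (n + 1 + 1) • o) ≤
        gromovProduct o (s • o) (s⁻¹ • o) + D := by
      rw [pow_succ' s (n + 1), mul_smul, gromovProduct_smul]
      exact ih
    have h2 := gromovProduct_add_gromovProduct (s • o) (s • s • o) (s ^ (n + 1 + 1) • o)
    rw [dist_smul] at h2
    have h3 := hD (s • o) o (s ^ (n + 1 + 1) • o) (s • s • o)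
    have h4 : gromovProduct (s • o) o (s • s • o) = gromovProduct o (s • o) (s⁻¹ • o) := by
      rw [gromovProduct_smul_base, inv_smul_smul, gromovProduct_comm]
    rw [h4, gromovProduct_comm _ (s ^ (n + 1 + 1) • o)] at h3
    by_contra! hcon
    have h5 : gromovProduct o (s • o) (s⁻¹ • o) + D <
      min (gromovProduct (s • o) o (s ^ (n + 1 + 1) • o))
        (gromovProduct (s • o) (s • s • o) (s ^ (n + 1 + 1) • o)) :=
      lt_min hcon (by linarith)
    linarith

theorem dist_pow_smul_add_one_le (hD : FourPointHyperbolic X D) (hD0 : 0 ≤ D)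
    (hs : dist o (s • o) + 2 * D + 1 ≤ dist o (s ^ 2 • o)) (n : ℕ) :
    dist o (s ^ n • o) + 1 ≤ dist o (s ^ (n + 1) • o) := by
  have h1 := gromovProduct_smul_pow_le hD hD0 hs n
  have hsq := dist_sq_smul s o
  have h2 : dist (s • o) (s ^ (n + 1) • o) = dist o (s ^ n • o) := by
    rw [pow_succ', mul_smul, dist_smul]
  have h3 : gromovProduct (s • o) o (s ^ (n + 1) • o) =
    (dist o (s • o) + dist o (s ^ n • o) - dist o (s ^ (n + 1) • o)) / 2 := by
    simp only [gromovProduct, h2, dist_comm (s • o) o]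
  linarith

theorem dist_pow_smul_add_le (hD : FourPointHyperbolic X D) (hD0 : 0 ≤ D)
    (hs : dist o (s • o) + 2 * D + 1 ≤ dist o (s ^ 2 • o)) (n m : ℕ) :
    dist o (s ^ n • o) + m ≤ dist o (s ^ (n + m) • o) := by
  induction m with
  | zero => simp
  | succ m ih =>
    have := dist_pow_smul_add_one_le hD hD0 hs (n + m)
    push_cast
    rw [← add_assoc n m 1]
    linarith

theorem le_dist_pow_smul (hD : FourPointHyperbolic X D) (hD0 : 0 ≤ D)
    (hs : dist o (s • o) + 2 * D + 1 ≤ dist o (s ^ 2 • o)) (n : ℕ) :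
    (n : ℝ) ≤ dist o (s ^ n • o) := by
  simpa using dist_pow_smul_add_le hD hD0 hs 0 n

theorem tendsto_dist_pow_smul (hD : FourPointHyperbolic X D) (hD0 : 0 ≤ D)
    (hs : dist o (s • o) + 2 * D + 1 ≤ dist o (s ^ 2 • o)) :
    Tendsto (fun n : ℕ => dist o (s ^ n • o)) atTop atTop :=
  tendsto_atTop_mono (le_dist_pow_smul hD hD0 hs) tendsto_natCast_atTop_atTop

theorem gromovAsymptotic_pow_smul (hD : FourPointHyperbolic X D) (hD0 : 0 ≤ D)
    (hs : dist o (s • o) + 2 * D + 1 ≤ dist o (s ^ 2 • o)) :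
    GromovAsymptotic (fun n : ℕ => s ^ n • o) (fun n : ℕ => s ^ n • o) := by
  have key : ∀ i j : ℕ, i ≤ j → (i : ℝ) ≤ gromovProduct o (s ^ i • o) (s ^ j • o) := by
    intro i j hij
    obtain ⟨k, rfl⟩ := Nat.exists_eq_add_of_le' hij
    have h1 := dist_pow_smul_add_le hD hD0 hs k i
    have h2 := le_dist_pow_smul hD hD0 hs i
    have h3 : dist (s ^ i • o) (s ^ (k + i) • o) = dist o (s ^ k • o) := by
      rw [add_comm k i, pow_add, mul_smul, dist_smul]
    simp only [gromovProduct, h3]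
    linarith
  refine GromovAsymptotic.of_eventually_le o fun R => ?_
  obtain ⟨N, hN⟩ := exists_nat_ge R
  refine ⟨N, fun i hi j hj => ?_⟩
  have hi' : (N : ℝ) ≤ i := by exact_mod_cast hi
  have hj' : (N : ℝ) ≤ j := by exact_mod_cast hj
  rcases le_total i j with h | h
  · linarith [key i j h]
  · rw [gromovProduct_comm]
    linarith [key j i h]

/-- Fekete's lemma gives the limit at `o`, and growth by at least 1 per power makes it at least 1.
Changing the base point costs a bounded error. -/
theorem isLoxodromic_of_dist_sq (hD : FourPointHyperbolic X D) (hD0 : 0 ≤ D)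
    (hs : dist o (s • o) + 2 * D + 1 ≤ dist o (s ^ 2 • o)) : IsLoxodromic X s := by
  have hsub : Subadditive fun n : ℕ => dist (s ^ n • o) o := by
    intro m n
    have := dist_triangle (s ^ (m + n) • o) (s ^ m • o) o
    rw [pow_add, mul_smul, dist_smul] at this
    simp only [pow_add, mul_smul]
    linarith
  have hlim := hsub.tendsto_lim ⟨0, by
    rintro _ ⟨n, rfl⟩
    positivity⟩
  refine ⟨hsub.lim, ?_, fun x => ?_⟩
  · refine lt_of_lt_of_le one_pos (ge_of_tendsto hlim ?_)
    filter_upwards [eventually_gt_atTop 0] with n hn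
    have hn' : (0 : ℝ) < n := by exact_mod_cast hn
    rw [le_div_iff₀ hn', one_mul, dist_comm]
    exact le_dist_pow_smul hD hD0 hs n
  · have h0 : Tendsto (fun n : ℕ => 2 * dist x o / (n : ℝ)) atTop (𝓝 0) :=
      tendsto_const_div_atTop_nhds_zero_nat _
    have hdiff : Tendsto (fun n : ℕ => dist (s ^ n • x) x / n - dist (s ^ n • o) o / n)
        atTop (𝓝 0) := by
      refine squeeze_zero_norm (fun n => ?_) h0
      rw [← sub_div, Real.norm_eq_abs, abs_div, Nat.abs_cast]
      gcongr
      have h1 := dist_triangle4 (s ^ n • x) (s ^ n • o) o x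
      have h2 := dist_triangle4 (s ^ n • o) (s ^ n • x) x o
      rw [dist_smul] at h1 h2
      rw [dist_comm o x] at h1 h2
      rw [abs_le]
      constructor <;> linarith
    simpa using hdiff.add hlim

end Displacement

/-- A fixed boundary point lies in the direction of `s o` or of `s⁻¹ o`: the products `(s o, s y)_o`
and `(s⁻¹ o, y)_o` add up to `d(o, s o)`, and `s y` is asymptotic to `y`. -/
theorem gromovProduct_add_ge_of_fixed {D : ℝ} (hD : FourPointHyperbolic X D) {s : G} {y : ℕ → X}
    (h : GromovAsymptotic y (fun n => s • y n)) (o : X) :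
    ∀ᶠ i in atTop, dist o (s • o) - D ≤
      gromovProduct o (y i) (s • o) + gromovProduct o (y i) (s⁻¹ • o) := by
  filter_upwards [(h.tendsto_diag o).eventually_ge_atTop (dist o (s • o))] with i hi
  have h1 := hD o (y i) (s • y i) (s • o)
  have h2 := gromovProduct_add_gromovProduct o (s • o) (s • y i)
  rw [gromovProduct_smul_base s o o, inv_smul_smul, gromovProduct_comm o (s⁻¹ • o),
    gromovProduct_comm o (s • o)] at h2
  have h3 := gromovProduct_nonneg o (y i) (s⁻¹ • o)
  have h4 := le_min (show dist o (s • o) - gromovProduct o (y i) (s⁻¹ • o) ≤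
    gromovProduct o (y i) (s • y i) by linarith) (show _ ≤ gromovProduct o (s • y i) (s • o) by
      linarith)
  linarith

end Isometries

/-! ### Fixed points and independence of loxodromic elements. -/

section Loxodromics

variable {G : Type*} [Group G] {X : Type*} [MetricSpace X] [MulAction G X] [IsIsometricSMul G X]

theorem GromovAsymptotic.smul_of_commute {f t : G} {o : X} (hft : Commute f t)
    (h : GromovAsymptotic (fun n : ℕ => t ^ n • o) (fun n : ℕ => t ^ n • o)) :
    GromovAsymptotic (fun n : ℕ => t ^ n • o) (fun n : ℕ => f • t ^ n • o) :=
  h.right_of_dist_le (K := dist (f • o) o) fun n => by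
    rw [← mul_smul, (hft.pow_right n).eq, mul_smul, dist_smul]

theorem dist_sq_smul_inv {t : G} {o : X} {C : ℝ}
    (h : dist o (t • o) + C ≤ dist o (t ^ 2 • o)) :
    dist o (t⁻¹ • o) + C ≤ dist o (t⁻¹ ^ 2 • o) := by
  rwa [inv_pow, dist_inv_smul_self, dist_inv_smul_self]

/-- A loxodromic element fixes the boundary points that are fixed by one of its powers. -/
theorem IsLoxodromic.smul_eq_of_pow_smul_eq [Nonempty X] {D : ℝ} (hD : FourPointHyperbolic X D)
    {g : G} (hg : IsLoxodromic X g) {ξ : GromovBoundary X} {k : ℕ} (hk : 0 < k)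
    (h : g ^ k • ξ = ξ) : g • ξ = ξ := by
  have o : X := Classical.arbitrary X
  have hD0 := hD.nonneg
  obtain ⟨N, -, hN⟩ := hg.exists_pow o (2 * D + 1)
  rw [← add_assoc] at hN
  have hN' : dist o ((g ^ N)⁻¹ • o) + 2 * D + 1 ≤ dist o ((g ^ N)⁻¹ ^ 2 • o) := by
    rw [add_assoc] at hN ⊢
    exact dist_sq_smul_inv hN
  have hx := gromovAsymptotic_pow_smul hD hD0 hN
  have hx' := gromovAsymptotic_pow_smul hD hD0 hN'
  obtain ⟨y, rfl⟩ : ∃ y : GromovSequence X, y.toBoundary = ξ := Quot.exists_rep ξ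
  have fixed_of : ∀ t : G, Commute g t →
      GromovAsymptotic (fun n : ℕ => t ^ n • o) (fun n : ℕ => t ^ n • o) →
      GromovAsymptotic y.1 (fun n : ℕ => t ^ n • o) →
      g • y.toBoundary = y.toBoundary := by
    intro t hgt ht hy
    refine (GromovSequence.smul_toBoundary_eq_iff hD).2 ?_
    exact ((hy.trans hD (ht.smul_of_commute hgt)).trans hD (hy.symm.smul g)).symm
  have hcomm : Commute g (g ^ N) := Commute.self_pow g N
  by_cases hy : GromovAsymptotic y.1 (fun n : ℕ => (g ^ N) ^ n • o)
  · exact fixed_of _ hcomm hx hy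
  by_cases hy' : GromovAsymptotic y.1 (fun n : ℕ => (g ^ N)⁻¹ ^ n • o)
  · exact fixed_of _ hcomm.inv_right hx' hy'
  -- Away from both endpoints of `g ^ N`, products with its powers stay below `K` and `K'`. But `(g
  -- ^ N) ^ (k * n)` fixes the point, which bounds its displacement by `K + K' + D`.
  exfalso
  obtain ⟨K, M, hM⟩ := GromovAsymptotic.exists_le_of_not hD y.2 hx hy o
  obtain ⟨K', M', hM'⟩ := GromovAsymptotic.exists_le_of_not hD y.2 hx' hy' o
  obtain ⟨n, hn, hnM, hnM'⟩ := (((tendsto_dist_pow_smul hD hD0 hN).eventually_gt_atTop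
    (K + K' + D)).and ((eventually_ge_atTop M).and (eventually_ge_atTop M'))).exists
  have hpow : (g ^ k) ^ (N * n) = (g ^ N) ^ (k * n) := by
    rw [← pow_mul, ← pow_mul, ← mul_assoc, ← mul_assoc, mul_comm k N]
  have hfix : ((g ^ N) ^ (k * n)) • y.toBoundary = y.toBoundary := by
    rw [← hpow]
    exact MulAction.mem_stabilizer_iff.1 (pow_mem (MulAction.mem_stabilizer_iff.2 h) (N * n))
  have hkn : n ≤ k * n := Nat.le_mul_of_pos_left n hk
  have hlarge := dist_pow_smul_add_le hD hD0 hN n (k * n - n)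
  rw [Nat.add_sub_cancel' hkn] at hlarge
  obtain ⟨i, hi, hiM, hiM'⟩ := ((gromovProduct_add_ge_of_fixed hD
    ((GromovSequence.smul_toBoundary_eq_iff hD).1 hfix).symm o).and
      ((eventually_ge_atTop M).and (eventually_ge_atTop M'))).exists
  have h1 := hM i hiM (k * n) (hnM.trans hkn)
  have h2 := hM' i hiM' (k * n) (hnM'.trans hkn)
  rw [← inv_pow] at hi
  have h3 : (0 : ℝ) ≤ (k * n - n : ℕ) := Nat.cast_nonneg _
  linarith

theorem eventually_isLoxodromic {D : ℝ} (hD : FourPointHyperbolic X D) (hD0 : 0 ≤ D) {s : ℕ → G}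
    {o : X} (h : GromovAsymptotic (fun n => s n • o) (fun n => s n • o))
    (h' : GromovAsymptotic (fun n => (s n)⁻¹ • o) (fun n => (s n)⁻¹ • o))
    (hne : ¬ GromovAsymptotic (fun n => s n • o) (fun n => (s n)⁻¹ • o)) :
    ∀ᶠ n in atTop, IsLoxodromic X (s n) := by
  obtain ⟨K, N, hK⟩ := GromovAsymptotic.exists_le_of_not hD h h' hne o
  filter_upwards [(h.tendsto_diag o).eventually_ge_atTop (2 * K + 2 * D + 1),
    eventually_ge_atTop N] with n hn hnN
  refine isLoxodromic_of_dist_sq (o := o) hD hD0 ?_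
  have h1 := hK n hnN n hnN
  have h2 : gromovProduct o (s n • o) (s n • o) = dist o (s n • o) := by
    simp [gromovProduct]
  rw [dist_sq_smul]
  linarith

theorem eventually_disjoint_boundaryFixedPoints [Nonempty X] {D : ℝ}
    (hD : FourPointHyperbolic X D) {s t : ℕ → G} {o : X}
    (hs : GromovAsymptotic (fun n => s n • o) (fun n => s n • o))
    (hs' : GromovAsymptotic (fun n => (s n)⁻¹ • o) (fun n => (s n)⁻¹ • o))
    (ht : GromovAsymptotic (fun n => t n • o) (fun n => t n • o))
    (ht' : GromovAsymptotic (fun n => (t n)⁻¹ • o) (fun n => (t n)⁻¹ • o))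
    (h₁ : ¬ GromovAsymptotic (fun n => s n • o) (fun n => t n • o))
    (h₂ : ¬ GromovAsymptotic (fun n => s n • o) (fun n => (t n)⁻¹ • o))
    (h₃ : ¬ GromovAsymptotic (fun n => (s n)⁻¹ • o) (fun n => t n • o))
    (h₄ : ¬ GromovAsymptotic (fun n => (s n)⁻¹ • o) (fun n => (t n)⁻¹ • o)) :
    ∀ᶠ n in atTop, Disjoint (boundaryFixedPoints X (s n)) (boundaryFixedPoints X (t n)) := by
  have self : ∀ g : G, gromovProduct o (g • o) (g • o) = dist o (g • o) := fun g => by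
    simp [gromovProduct]
  obtain ⟨K₁, N₁, hK₁⟩ := GromovAsymptotic.exists_le_of_not hD hs ht h₁ o
  obtain ⟨K₂, N₂, hK₂⟩ := GromovAsymptotic.exists_le_of_not hD hs ht' h₂ o
  obtain ⟨K₃, N₃, hK₃⟩ := GromovAsymptotic.exists_le_of_not hD hs' ht h₃ o
  obtain ⟨K₄, N₄, hK₄⟩ := GromovAsymptotic.exists_le_of_not hD hs' ht' h₄ o
  set K := max (max K₁ K₂) (max K₃ K₄) with hK
  -- A common fixed point has two products summing to more than `2K + 2D` for each element, so one
  -- of each pair exceeds `K + D`; one more four-point loss of `D` still contradicts the bound `K`.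
  filter_upwards [(hs.tendsto_diag o).eventually_gt_atTop (2 * K + 3 * D),
    (ht.tendsto_diag o).eventually_gt_atTop (2 * K + 3 * D),
    eventually_ge_atTop N₁, eventually_ge_atTop N₂, eventually_ge_atTop N₃,
    eventually_ge_atTop N₄] with n hsn htn hn₁ hn₂ hn₃ hn₄
  rw [self] at hsn htn
  rw [Set.disjoint_left]
  rintro ⟨y⟩ hys hyt
  have hys' : GromovAsymptotic y.1 (fun i => s n • y.1 i) :=
    ((GromovSequence.smul_toBoundary_eq_iff hD).1 hys).symm
  have hyt' : GromovAsymptotic y.1 (fun i => t n • y.1 i) :=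
    ((GromovSequence.smul_toBoundary_eq_iff hD).1 hyt).symm
  obtain ⟨i, hi, hi'⟩ := ((gromovProduct_add_ge_of_fixed hD hys' o).and
    (gromovProduct_add_ge_of_fixed hD hyt' o)).exists
  have key : ∀ a b : X, gromovProduct o a b ≤ K → K + D < gromovProduct o (y.1 i) a →
      K + D < gromovProduct o (y.1 i) b → False := by
    intro a b hab ha hb
    have h1 := hD o a (y.1 i) b
    rw [gromovProduct_comm o a (y.1 i)] at h1
    have h2 := lt_min ha hb
    linarith
  have e₁ : K₁ ≤ K := (le_max_left _ _).trans (le_max_left _ _)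
  have e₂ : K₂ ≤ K := (le_max_right _ _).trans (le_max_left _ _)
  have e₃ : K₃ ≤ K := (le_max_left _ _).trans (le_max_right _ _)
  have e₄ : K₄ ≤ K := (le_max_right _ _).trans (le_max_right _ _)
  have hsplit : ∀ u v w : ℝ, 2 * K + 3 * D < w → w - D ≤ u + v → K + D < u ∨ K + D < v := by
    intro u v w hw huv
    by_contra! hcon
    linarith [hcon.1, hcon.2]
  rcases hsplit _ _ _ hsn hi with ha | ha <;> rcases hsplit _ _ _ htn hi' with hb | hb
  · exact key _ _ ((hK₁ n hn₁ n hn₁).trans e₁) ha hb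
  · exact key _ _ ((hK₂ n hn₂ n hn₂).trans e₂) ha hb
  · exact key _ _ ((hK₃ n hn₃ n hn₃).trans e₃) ha hb
  · exact key _ _ ((hK₄ n hn₄ n hn₄).trans e₄) ha hb

theorem gromovAsymptotic_smul_mul_smul [Nonempty X] {o : X} {x : ℕ → X} {k : ℕ → G}
    (h : GromovAsymptotic x (fun n => k n • o)) (a c : G) :
    GromovAsymptotic (fun n => a • x n) (fun n => (a * k n * c) • o) :=
  (h.smul a).right_of_dist_le (K := dist (c • o) o) fun n => by
    rw [mul_smul, mul_smul, dist_smul, dist_smul]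

/-- If `k n` and `(k n)⁻¹` both push a base point towards the boundary point `ξ`, then
`a * k n * b⁻¹` is, for large `n`, loxodromic with endpoints near `a • ξ ≠ b • ξ`. -/
theorem eventually_areIndependentLoxodromics [Nonempty X] {D : ℝ}
    (hD : FourPointHyperbolic X D) {o : X} {x : GromovSequence X} {k : ℕ → G}
    (hk : GromovAsymptotic x.1 (fun n => k n • o))
    (hk' : GromovAsymptotic x.1 (fun n => (k n)⁻¹ • o)) {ξ : GromovBoundary X}
    (hξ : ξ = x.toBoundary) {a b c d : G} (hab : a • ξ ≠ b • ξ) (hcd : c • ξ ≠ d • ξ)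
    (hac : a • ξ ≠ c • ξ) (had : a • ξ ≠ d • ξ) (hbc : b • ξ ≠ c • ξ) (hbd : b • ξ ≠ d • ξ) :
    ∀ᶠ n in atTop, AreIndependentLoxodromics X (a * k n * b⁻¹) (c * k n * d⁻¹) := by
  subst hξ
  have hpos : ∀ a b : G, GromovAsymptotic (fun n => a • x.1 n)
      (fun n => (a * k n * b⁻¹) • o) := fun a b =>
    gromovAsymptotic_smul_mul_smul hk a b⁻¹
  have hneg : ∀ a b : G, GromovAsymptotic (fun n => b • x.1 n)
      (fun n => (a * k n * b⁻¹)⁻¹ • o) := fun a b => by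
    have := gromovAsymptotic_smul_mul_smul hk' b a⁻¹
    simpa only [mul_inv_rev, inv_inv, mul_assoc] using this
  have hself : ∀ {u v : ℕ → X}, GromovAsymptotic u v → GromovAsymptotic v v := fun h =>
    h.symm.trans hD h
  have hne : ∀ {a b : G} {u v : ℕ → X},
      a • x.toBoundary ≠ b • x.toBoundary →
      GromovAsymptotic (fun n => a • x.1 n) u → GromovAsymptotic (fun n => b • x.1 n) v →
      ¬ GromovAsymptotic u v := fun hab hu hv h =>
    hab ((GromovSequence.smul_toBoundary_eq_smul_iff hD).2 ((hu.trans hD h).trans hD hv.symm))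
  filter_upwards [eventually_isLoxodromic hD hD.nonneg (hself (hpos a b)) (hself (hneg a b))
      (hne hab (hpos a b) (hneg a b)),
    eventually_isLoxodromic hD hD.nonneg (hself (hpos c d)) (hself (hneg c d))
      (hne hcd (hpos c d) (hneg c d)),
    eventually_disjoint_boundaryFixedPoints hD (hself (hpos a b)) (hself (hneg a b))
      (hself (hpos c d)) (hself (hneg c d)) (hne hac (hpos a b) (hpos c d))
      (hne had (hpos a b) (hneg c d)) (hne hbc (hneg a b) (hpos c d))
      (hne hbd (hneg a b) (hneg c d))] with n h1 h2 h3
  exact ⟨h1, h2, h3⟩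

/-- A nonelementary subgroup has an infinite orbit in the boundary of a point towards which both
`k n` and `(k n)⁻¹` push a base point, for some sequence `k` in the subgroup. -/
theorem exists_gromovSequence_of_independent [Nonempty X] {D : ℝ}
    (hD : FourPointHyperbolic X D) (o : X) {H : Subgroup G} {f g : G} (hf : f ∈ H) (hg : g ∈ H)
    (hfg : AreIndependentLoxodromics X f g) :
    ∃ (x : GromovSequence X) (k : ℕ → G), (∀ n, k n ∈ H) ∧
      GromovAsymptotic x.1 (fun n => k n • o) ∧ GromovAsymptotic x.1 (fun n => (k n)⁻¹ • o) ∧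
      Function.Injective fun j : ℕ => g ^ j • x.toBoundary := by
  obtain ⟨hlf, hlg, hdisj⟩ := hfg
  have hD0 := hD.nonneg
  obtain ⟨N, -, hN⟩ := hlf.exists_pow o (2 * D + 1)
  rw [← add_assoc] at hN
  have hN' : dist o ((f ^ N)⁻¹ • o) + 2 * D + 1 ≤ dist o ((f ^ N)⁻¹ ^ 2 • o) := by
    rw [add_assoc] at hN ⊢
    exact dist_sq_smul_inv hN
  have hcomm : Commute f (f ^ N) := Commute.self_pow f N
  set t := f ^ N with ht
  have hx := gromovAsymptotic_pow_smul hD hD0 hN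
  have hx' := gromovAsymptotic_pow_smul hD hD0 hN'
  have not_fixed : ∀ u : G, Commute f u →
      ∀ hu : GromovAsymptotic (fun n : ℕ => u ^ n • o) (fun n : ℕ => u ^ n • o),
      g • GromovSequence.toBoundary ⟨_, hu⟩ ≠ GromovSequence.toBoundary ⟨_, hu⟩ := by
    intro u hfu hu hgu
    refine Set.disjoint_left.1 hdisj ?_ hgu
    exact (GromovSequence.smul_toBoundary_eq_iff hD).2 (hu.smul_of_commute hfu).symm
  -- If `q` moves the repelling point, `t⁻ⁿ o` and `q t⁻ⁿ o` have bounded product. Translating by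
  -- `tⁿ`, the product of `tⁿ o` and `tⁿ q t⁻ⁿ o` at `o` is within a constant of `d(o, tⁿ o)`.
  have hpush : ∀ q : G, q • GromovSequence.toBoundary ⟨_, hx'⟩ ≠ GromovSequence.toBoundary ⟨_, hx'⟩ →
      GromovAsymptotic (fun n : ℕ => t ^ n • o) (fun n : ℕ => (t ^ n * q * (t ^ n)⁻¹) • o) := by
    intro q hq
    have hna : ¬ GromovAsymptotic (fun n : ℕ => t⁻¹ ^ n • o) (fun n : ℕ => q • t⁻¹ ^ n • o) :=
      fun h => hq ((GromovSequence.smul_toBoundary_eq_iff hD).2 h.symm)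
    obtain ⟨K, M, hK⟩ := GromovAsymptotic.exists_le_of_not hD hx' (hx'.smul q) hna o
    refine GromovAsymptotic.of_tendsto_diag hD hx o ?_
    refine tendsto_atTop_mono' _ ?_
      (tendsto_atTop_add_const_right _ (-K) (tendsto_dist_pow_smul hD hD0 hN))
    filter_upwards [eventually_ge_atTop M] with n hn
    have h1 := hK n hn n hn
    have h2 := gromovProduct_add_gromovProduct o (t ^ n • o) ((t ^ n * q * (t ^ n)⁻¹) • o)
    rw [gromovProduct_smul_base (t ^ n) o o, mul_smul, mul_smul, inv_smul_smul, ← inv_pow,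
      gromovProduct_comm o (t ^ n • o)] at h2
    rw [mul_smul, mul_smul, gromovProduct_comm, ← inv_pow]
    linarith
  refine ⟨⟨_, hx⟩, fun n => t ^ n * g * (t ^ n)⁻¹, fun n => ?_, ?_, ?_, ?_⟩
  · have : t ^ n ∈ H := H.pow_mem (H.pow_mem hf N) n
    exact H.mul_mem (H.mul_mem this hg) (H.inv_mem this)
  · exact hpush g (not_fixed _ hcomm.inv_right hx')
  · have := hpush g⁻¹ fun h => not_fixed _ hcomm.inv_right hx' (inv_smul_eq_iff.1 h).symm
    simpa only [mul_inv_rev, inv_inv, mul_assoc] using this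
  · have key : ∀ i m : ℕ, g ^ i • GromovSequence.toBoundary ⟨_, hx⟩ =
        g ^ (i + m) • GromovSequence.toBoundary ⟨_, hx⟩ → m = 0 := by
      intro i m h
      rw [pow_add, mul_smul] at h
      by_contra hm
      exact not_fixed _ hcomm hx
        (hlg.smul_eq_of_pow_smul_eq hD (Nat.pos_of_ne_zero hm) (smul_left_cancel _ h).symm)
    intro i j hij
    rcases le_total i j with h | h
    · obtain ⟨m, rfl⟩ := Nat.exists_eq_add_of_le h
      simp [key i m hij]
    · obtain ⟨m, rfl⟩ := Nat.exists_eq_add_of_le h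
      simp [key j m hij.symm]

end Loxodromics

/-! ### Covering by finitely many two-sided translates. -/

theorem exists_forall_smul_notMem {G Y : Type*} [Group G] [MulAction G Y] {y : ℕ → Y}
    (hy : Function.Injective y) {F : Set G} (hF : F.Finite) {T : Set Y} (hT : T.Finite) :
    ∃ j, ∀ c ∈ F, c • y j ∉ T := by
  have : (⋃ c ∈ F, (fun j => c • y j) ⁻¹' T).Finite :=
    hF.biUnion fun c _ => hT.preimage ((MulAction.injective c).comp hy).injOn
  obtain ⟨j, hj⟩ := this.exists_notMem
  exact ⟨j, fun c hc hcj => hj (Set.mem_biUnion hc hcj)⟩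

/-- A set `L` such that finitely many two-sided translates of `L` cover a nonelementary subgroup is
nonelementary. -/
theorem IsNonelementary.of_subset_mul_mul {G : Type*} [Group G] {X : Type*} [MetricSpace X]
    [Nonempty X] [MulAction G X] [IsIsometricSMul G X] {D : ℝ} (hD : FourPointHyperbolic X D)
    {H : Subgroup G} (hH : IsNonelementary X (H : Set G)) {L B : Set G} (hB : B.Finite)
    (hHB : (H : Set G) ⊆ B * L * B) : IsNonelementary X L := by
  obtain ⟨f, hf, g, hg, hfg⟩ := hH
  obtain ⟨x, k, hkH, hk, hk', hinj⟩ :=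
    exists_gromovSequence_of_independent hD (Classical.arbitrary X) hf hg hfg
  set ξ := x.toBoundary with hξ
  -- Corrections act on the limit points by `b⁻¹` on the left and by `b'` on the right, hence the
  -- symmetrized set.
  have hF : (B ∪ B⁻¹).Finite := hB.union hB.inv
  set F := B ∪ B⁻¹
  have hT : ∀ j : ℕ, ((fun c : G => c • g ^ j • ξ) '' F).Finite := fun j => hF.image _
  obtain ⟨q, hq⟩ := exists_forall_smul_notMem hinj hF (hT 0)
  obtain ⟨r, hr⟩ := exists_forall_smul_notMem hinj hF ((hT 0).union (hT q))
  obtain ⟨s, hs⟩ := exists_forall_smul_notMem hinj hF (((hT 0).union (hT q)).union (hT r))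
  have sep : ∀ {i j : ℕ}, (∀ c ∈ F, c • g ^ j • ξ ∉ (fun c : G => c • g ^ i • ξ) '' F) →
      ∀ b ∈ F, ∀ c ∈ F, (b * g ^ i) • ξ ≠ (c * g ^ j) • ξ := by
    intro i j h b hb c hc hbc
    rw [mul_smul, mul_smul] at hbc
    exact h c hc ⟨b, hb, hbc⟩
  -- The corrections supplied by the covering depend on `n`, so `n` must first be chosen to work for
  -- every quadruple from `B`.
  have hev : ∀ᶠ n in atTop, ∀ b ∈ B, ∀ b' ∈ B, ∀ c ∈ B, ∀ c' ∈ B, AreIndependentLoxodromics X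
      (b⁻¹ * g ^ 0 * k n * (b' * g ^ q)⁻¹) (c⁻¹ * g ^ r * k n * (c' * g ^ s)⁻¹) := by
    refine hB.eventually_all.2 fun b hb => hB.eventually_all.2 fun b' hb' =>
      hB.eventually_all.2 fun c hc => hB.eventually_all.2 fun c' hc' => ?_
    have mb : b⁻¹ ∈ F := Or.inr (Set.inv_mem_inv.2 hb)
    have mc : c⁻¹ ∈ F := Or.inr (Set.inv_mem_inv.2 hc)
    have mb' : b' ∈ F := Or.inl hb'
    have mc' : c' ∈ F := Or.inl hc'
    exact eventually_areIndependentLoxodromics hD hk hk' hξ (sep hq _ mb _ mb')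
      (sep (fun e he hm => hs e he (Or.inr hm)) _ mc _ mc')
      (sep (fun e he hm => hr e he (Or.inl hm)) _ mb _ mc)
      (sep (fun e he hm => hs e he (Or.inl (Or.inl hm))) _ mb _ mc')
      (sep (fun e he hm => hr e he (Or.inr hm)) _ mb' _ mc)
      (sep (fun e he hm => hs e he (Or.inl (Or.inr hm))) _ mb' _ mc')
  obtain ⟨n, hn⟩ := hev.exists
  have cover : ∀ i j : ℕ, ∃ b ∈ B, ∃ b' ∈ B, b⁻¹ * g ^ i * k n * (b' * g ^ j)⁻¹ ∈ L := by
    intro i j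
    have hmem : g ^ i * k n * (g ^ j)⁻¹ ∈ (H : Set G) :=
      H.mul_mem (H.mul_mem (H.pow_mem hg i) (hkH n)) (H.inv_mem (H.pow_mem hg j))
    obtain ⟨_, ⟨b, hb, l, hl, rfl⟩, b', hb', h⟩ := hHB hmem
    refine ⟨b, hb, b', hb', ?_⟩
    have : b⁻¹ * g ^ i * k n * (b' * g ^ j)⁻¹ = b⁻¹ * (g ^ i * k n * (g ^ j)⁻¹) * b'⁻¹ := by
      group
    rw [this, ← h]
    simpa [mul_assoc] using hl
  obtain ⟨b, hb, b', hb', hL⟩ := cover 0 q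
  obtain ⟨c, hc, c', hc', hL'⟩ := cover r s
  exact ⟨_, hL, _, hL', hn b hb b' hb' c hc c' hc'⟩

theorem proposition6 {G : Type*} [Group G] {X : Type*} [MetricSpace X] [Nonempty X]
    [MulAction G X] [IsIsometricSMul G X]
    (hgeo : IsGeodesicSpace X) (δ : ℝ) (hhyp : IsSlimHyperbolic X δ)
    {V : Type*} [Quiver V] (Γ : GraphStructure G V)
    (lam : ℝ) (hss : Γ.IsAlmostSemisimple lam)
    (H : Subgroup G) (hH : IsNonelementary X (H : Set G))
    (hthick : Γ.IsThickRelativeTo lam H) :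
    ∀ v : V, Γ.IsMaximalVertex lam v →
      IsNonelementary X (Γ.loopSemigroup v : Set G) := by
  intro v hv
  obtain ⟨B, hB, hHB⟩ := hthick v hv
  exact hH.of_subset_mul_mul (hhyp.fourPoint hgeo) hB hHB
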